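/- Let $n>1$ and let $K,L\subset\mathbb R^n$ be non-empty closed convex sets. Write $|\cdot|$ for the volume and $g(x):=|K\cap(L+x)|$ for the cross covariogram of $K$ and $L$, and assume that $0<g(x)<\infty$ for some $x\in\mathbb R^n$. Assume in addition that $L$ is strictly convex, that is, for any two distinct points $x,y\in L$ and every $t\in(0,1)$, the point $(1-t)x+ty$ lies in the interior of $L$. Let $a,w\in\mathbb R^n$, and suppose that $t\mapsto g(a+tw)^{1/n}$ is affine and not identically zero on $[-1,1]$. Then $g^{1/n}$ is constant on the line segment with endpoints $a\pm w$. Moreover, unless $K$ is contained in the interior of $L+a$, \[ K\cap (L+a+tw)=K'\cap(L+a+tw)\qquad(-1\le t\le 1), \] where $K':=\{x+tw\mid x\in K,\ t\in\mathbb R\}$ is the cylinder in the direction of $w$ generated by $K$; and for every $z\in\partial K\cap(L+a)$, the boundary $\partial K$ contains the line segment with endpoints $z\pm w$. -/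

import Mathlib

open Set MeasureTheory
open scoped ENNReal

/-- The translate `L + x`. -/
def translateSet {n : ℕ} (L : Set (EuclideanSpace ℝ (Fin n))) (x : EuclideanSpace ℝ (Fin n)) :
    Set (EuclideanSpace ℝ (Fin n)) :=
  (fun y => y + x) '' L

/-- The cross covariogram `g_{K,L}(x) = |K ∩ (L + x)|`, which may be infinite. -/
noncomputable def crossCovariogram {n : ℕ} (K L : Set (EuclideanSpace ℝ (Fin n)))
    (x : EuclideanSpace ℝ (Fin n)) : ℝ≥0∞ :=
  volume (K ∩ translateSet L x)

/-- The function `g_{K,L}^{1/n}`. -/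
noncomputable def crossCovariogramRoot {n : ℕ} (K L : Set (EuclideanSpace ℝ (Fin n)))
    (x : EuclideanSpace ℝ (Fin n)) : ℝ≥0∞ :=
  crossCovariogram K L x ^ (1 / (n : ℝ))

/-- The dimension is greater than one, `K` and `L` are non-empty closed convex sets, and the cross
covariogram takes a positive finite value somewhere. -/
structure StandingHypothesis {n : ℕ} (K L : Set (EuclideanSpace ℝ (Fin n))) : Prop where
  one_lt_dim : 1 < n
  nonempty_left : K.Nonempty
  nonempty_right : L.Nonempty
  isClosed_left : IsClosed K
  isClosed_right : IsClosed L
  convex_left : Convex ℝ K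
  convex_right : Convex ℝ L
  exists_pos_finite : ∃ x, 0 < crossCovariogram K L x ∧ crossCovariogram K L x < ∞

/-- A non-negative function `f` is affine on the segment with endpoints `a ± w`: its values there
are finite, and are given by a real affine function of the parameter. The condition
`0 ≤ α + β * t` prevents `ENNReal.ofReal` from truncating negative values. -/
def IsAffineOnSegment {n : ℕ} (f : EuclideanSpace ℝ (Fin n) → ℝ≥0∞)
    (a w : EuclideanSpace ℝ (Fin n)) : Prop :=
  ∃ α β : ℝ, ∀ t ∈ Icc (-1 : ℝ) 1,
    0 ≤ α + β * t ∧ f (a + t • w) = ENNReal.ofReal (α + β * t)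

/-- The cylinder in the direction of `w` generated by `K`. -/
def cylinderSet {n : ℕ} (K : Set (EuclideanSpace ℝ (Fin n))) (w : EuclideanSpace ℝ (Fin n)) :
    Set (EuclideanSpace ℝ (Fin n)) :=
  {z | ∃ x ∈ K, ∃ t : ℝ, z = x + t • w}

/-! Put `B = K - a` and `D_s = L ∩ (B - s w)`, so that `g (a + s w) = |D_s|`. Convexity gives `(1-t)
D_s + t D_s' ⊆ D_((1-t)s+ts')`, so an affine `g^(1/n)` means equality in Brunn–Minkowski: the `D_s`,
`|s| < 1`, are homothetic and the inclusion is an equality. A point of `∂L` in the combination is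
then a mean of two points of `L`, which coincide by strict convexity. Hence `D_s ∩ ∂L` does not
depend on `s`.

This gives the dichotomy `shiftInter_const_or_subset`. If `B ∩ ∂L` has two points, the homothety
from `D_0` to `D_s` fixes both and is the identity, so `D_s = D_0`. Otherwise, as `n > 1`, `B - s w
⊆ L` for `|s| < 1` and `|D_s| = |B|`; a single point `p` of `B ∩ ∂L` would have `p ± w/2` in `L`,
forcing `w = 0`. In both cases `g` is constant. Unless `B` lies in the interior of `L`, all `D_s`
with `|s| ≤ 1` coincide, and `mem_of_add_smul_mem` turns this into the cylinder property.

The equality case of Brunn–Minkowski comes from one-dimensional Prékopa–Leindler by slicing. For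
equal volumes, equality makes the marginals in every direction translates of each other; the shifts
are those of the centroids, so both sets have the same supporting half-spaces up to one translation.
-/

/-! ### One-dimensional Prékopa–Leindler inequality by monotone transport. -/

/-- The quantile function of a continuous positive density on a bounded open interval. -/
theorem exists_quantile {a b : ℝ} (hab : a < b) {f : ℝ → ℝ} (hc : ContinuousOn f (Ioo a b))
    (hpos : ∀ x ∈ Ioo a b, 0 < f x) (hint : IntegrableOn f (Ioo a b))
    (h1 : ∫ x in Ioo a b, f x = 1) :
    ∃ p : ℝ → ℝ, BijOn p (Ioo 0 1) (Ioo a b) ∧ StrictMonoOn p (Ioo 0 1) ∧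
      ∀ θ ∈ Ioo (0 : ℝ) 1, HasDerivAt p (f (p θ))⁻¹ θ := by
  have hI : IntervalIntegrable f volume a b := by
    rw [intervalIntegrable_iff_integrableOn_Ioo_of_le hab.le]; exact hint
  set F : ℝ → ℝ := fun x => ∫ t in a..x, f t with hF
  have hFa : F a = 0 := intervalIntegral.integral_same
  have hFb : F b = 1 := by
    rw [hF]; simp only
    rw [intervalIntegral.integral_of_le hab.le, integral_Ioc_eq_integral_Ioo, h1]
  have hFc : ContinuousOn F (Icc a b) := by
    have := intervalIntegral.continuousOn_primitive_interval (μ := volume) (f := f) (a := a) (b := b)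
      (by rw [uIcc_of_le hab.le]; exact (integrableOn_Icc_iff_integrableOn_Ioo).2 hint)
    rwa [uIcc_of_le hab.le] at this
  have hFd : ∀ x ∈ Ioo a b, HasDerivAt F (f x) x := by
    intro x hx
    have hn : Ioo a b ∈ nhds x := isOpen_Ioo.mem_nhds hx
    refine intervalIntegral.integral_hasDerivAt_right ?_ ?_ (hc.continuousAt hn)
    · exact hI.mono_set (by
        rw [uIcc_of_le hab.le, uIcc_of_le hx.1.le]; exact Icc_subset_Icc_right hx.2.le)
    · exact hc.stronglyMeasurableAtFilter isOpen_Ioo x hx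
  have hFm : StrictMonoOn F (Icc a b) := by
    refine strictMonoOn_of_deriv_pos (convex_Icc a b) hFc ?_
    intro x hx
    rw [interior_Icc] at hx
    rw [(hFd x hx).deriv]; exact hpos x hx
  have hFm' : StrictMonoOn F (Ioo a b) := hFm.mono Ioo_subset_Icc_self
  have hmaps : MapsTo F (Ioo a b) (Ioo 0 1) := fun x hx =>
    ⟨hFa ▸ hFm (left_mem_Icc.2 hab.le) (Ioo_subset_Icc_self hx) hx.1,
      hFb ▸ hFm (Ioo_subset_Icc_self hx) (right_mem_Icc.2 hab.le) hx.2⟩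
  have hsurj : SurjOn F (Ioo a b) (Ioo 0 1) := by
    have := intermediate_value_Ioo hab.le hFc
    rwa [hFa, hFb] at this
  have hinv : InvOn (Function.invFunOn F (Ioo a b)) F (Ioo a b) (Ioo 0 1) :=
    BijOn.invOn_invFunOn ⟨hmaps, hFm'.injOn, hsurj⟩
  set p := Function.invFunOn F (Ioo a b) with hp
  have hpm : MapsTo p (Ioo 0 1) (Ioo a b) := hsurj.mapsTo_invFunOn
  have hbij : BijOn p (Ioo 0 1) (Ioo a b) := hinv.symm.bijOn hpm hmaps
  have hps : StrictMonoOn p (Ioo 0 1) := by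
    intro x hx y hy hxy
    rw [← hFm'.lt_iff_lt (hpm hx) (hpm hy), hinv.2 hx, hinv.2 hy]
    exact hxy
  refine ⟨p, hbij, hps, fun θ hθ => ?_⟩
  refine HasDerivAt.of_local_left_inverse ?_ (hFd _ (hpm hθ)) (hpos _ (hpm hθ)).ne' ?_
  · refine hps.continuousAt_of_image_mem_nhds (isOpen_Ioo.mem_nhds hθ) ?_
    rw [hbij.image_eq]; exact isOpen_Ioo.mem_nhds (hpm hθ)
  · filter_upwards [isOpen_Ioo.mem_nhds hθ] with x hx using hinv.2 hx

/-- The one-dimensional Prékopa–Leindler inequality for probability densities that are continuous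
and positive on bounded open intervals, together with its equality case. -/
theorem prekopa_leindler_real {a b c d : ℝ} (hab : a < b) (hcd : c < d) {f g : ℝ → ℝ}
    (hfc : ContinuousOn f (Ioo a b)) (hgc : ContinuousOn g (Ioo c d))
    (hfpos : ∀ x ∈ Ioo a b, 0 < f x) (hgpos : ∀ x ∈ Ioo c d, 0 < g x)
    (hfint : IntegrableOn f (Ioo a b)) (hgint : IntegrableOn g (Ioo c d))
    (hf1 : ∫ x in Ioo a b, f x = 1) (hg1 : ∫ x in Ioo c d, g x = 1)
    {μ : ℝ} (hμ0 : 0 < μ) (hμ1 : μ < 1) {h : ℝ → ℝ≥0∞}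
    (hh : ∀ x ∈ Ioo a b, ∀ y ∈ Ioo c d,
      ENNReal.ofReal (f x ^ (1 - μ) * g y ^ μ) ≤ h ((1 - μ) * x + μ * y)) :
    1 ≤ ∫⁻ x, h x ∧ (∫⁻ x, h x ≤ 1 → ∃ e, c = a + e ∧ d = b + e ∧
      ∀ x ∈ Ioo a b, g (x + e) = f x) := by
  obtain ⟨p, hpb, hpm, hpd⟩ := exists_quantile hab hfc hfpos hfint hf1
  obtain ⟨q, hqb, hqm, hqd⟩ := exists_quantile hcd hgc hgpos hgint hg1
  have hμ1' : 0 < 1 - μ := by linarith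
  set S : ℝ → ℝ := fun θ => (1 - μ) * p θ + μ * q θ with hS
  set S' : ℝ → ℝ := fun θ => (1 - μ) * (f (p θ))⁻¹ + μ * (g (q θ))⁻¹ with hS'
  have hSd : ∀ θ ∈ Ioo (0 : ℝ) 1, HasDerivAt S (S' θ) θ := fun θ hθ =>
    ((hpd θ hθ).const_mul _).add ((hqd θ hθ).const_mul _)
  have hSinj : InjOn S (Ioo 0 1) := by
    apply StrictMonoOn.injOn
    intro x hx y hy hxy
    have h1 := hpm hx hy hxy
    have h2 := hqm hx hy hxy
    simp only [hS]
    nlinarith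
  have hfp : ∀ θ ∈ Ioo (0 : ℝ) 1, 0 < f (p θ) := fun θ hθ => hfpos _ (hpb.mapsTo hθ)
  have hgq : ∀ θ ∈ Ioo (0 : ℝ) 1, 0 < g (q θ) := fun θ hθ => hgpos _ (hqb.mapsTo hθ)
  have hS'pos : ∀ θ ∈ Ioo (0 : ℝ) 1, 0 < S' θ := fun θ hθ =>
    add_pos (mul_pos hμ1' (inv_pos.2 (hfp θ hθ))) (mul_pos hμ0 (inv_pos.2 (hgq θ hθ)))
  set k : ℝ → ℝ := fun θ => S' θ * (f (p θ) ^ (1 - μ) * g (q θ) ^ μ) with hk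
  have hinvpow : ∀ θ ∈ Ioo (0 : ℝ) 1,
      (f (p θ))⁻¹ ^ (1 - μ) * (g (q θ))⁻¹ ^ μ * (f (p θ) ^ (1 - μ) * g (q θ) ^ μ) = 1 := by
    intro θ hθ
    have h1 := Real.rpow_pos_of_pos (hfp θ hθ) (1 - μ)
    have h2 := Real.rpow_pos_of_pos (hgq θ hθ) μ
    rw [Real.inv_rpow (hfp θ hθ).le, Real.inv_rpow (hgq θ hθ).le]
    field_simp
  have hprod : ∀ θ ∈ Ioo (0 : ℝ) 1, 0 < f (p θ) ^ (1 - μ) * g (q θ) ^ μ := fun θ hθ =>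
    mul_pos (Real.rpow_pos_of_pos (hfp θ hθ) _) (Real.rpow_pos_of_pos (hgq θ hθ) _)
  -- The arithmetic-geometric mean inequality for `1 / f (p θ)` and `1 / g (q θ)`.
  have hk1 : ∀ θ ∈ Ioo (0 : ℝ) 1, 1 ≤ k θ := by
    intro θ hθ
    rw [← hinvpow θ hθ]
    refine mul_le_mul_of_nonneg_right ?_ (hprod θ hθ).le
    exact Real.geom_mean_le_arith_mean2_weighted hμ1'.le hμ0.le (inv_pos.2 (hfp θ hθ)).le
      (inv_pos.2 (hgq θ hθ)).le (by ring)
  have hle : ∫⁻ θ in Ioo (0 : ℝ) 1, ENNReal.ofReal (k θ) ≤ ∫⁻ x, h x := by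
    calc ∫⁻ θ in Ioo (0 : ℝ) 1, ENNReal.ofReal (k θ)
        ≤ ∫⁻ θ in Ioo (0 : ℝ) 1, ENNReal.ofReal (|S' θ|) * h (S θ) := by
          refine setLIntegral_mono' measurableSet_Ioo fun θ hθ => ?_
          rw [hk, abs_of_pos (hS'pos θ hθ)]
          simp only
          rw [ENNReal.ofReal_mul (hS'pos θ hθ).le]
          gcongr
          exact hh _ (hpb.mapsTo hθ) _ (hqb.mapsTo hθ)
      _ = ∫⁻ x in S '' Ioo 0 1, h x :=
          (lintegral_image_eq_lintegral_abs_deriv_mul measurableSet_Ioo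
            (fun θ hθ => (hSd θ hθ).hasDerivWithinAt) hSinj h).symm
      _ ≤ ∫⁻ x, h x := setLIntegral_le_lintegral _ _
  have hone : ∫⁻ θ in Ioo (0 : ℝ) 1, (1 : ℝ≥0∞) = 1 := by simp
  have hge : 1 ≤ ∫⁻ θ in Ioo (0 : ℝ) 1, ENNReal.ofReal (k θ) := by
    rw [← hone]
    refine setLIntegral_mono' measurableSet_Ioo fun θ hθ => ?_
    rw [← ENNReal.ofReal_one]; exact ENNReal.ofReal_le_ofReal (hk1 θ hθ)
  refine ⟨hge.trans hle, fun hle1 => ?_⟩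
  have hpc : ContinuousOn p (Ioo 0 1) := fun θ hθ => (hpd θ hθ).continuousAt.continuousWithinAt
  have hqc : ContinuousOn q (Ioo 0 1) := fun θ hθ => (hqd θ hθ).continuousAt.continuousWithinAt
  have hfpc : ContinuousOn (fun θ => f (p θ)) (Ioo 0 1) := hfc.comp hpc hpb.mapsTo
  have hgqc : ContinuousOn (fun θ => g (q θ)) (Ioo 0 1) := hgc.comp hqc hqb.mapsTo
  have hkc : ContinuousOn k (Ioo 0 1) := by
    refine ContinuousOn.mul (ContinuousOn.add ?_ ?_) (ContinuousOn.mul ?_ ?_)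
    · exact continuousOn_const.mul (hfpc.inv₀ fun θ hθ => (hfp θ hθ).ne')
    · exact continuousOn_const.mul (hgqc.inv₀ fun θ hθ => (hgq θ hθ).ne')
    · exact hfpc.rpow_const fun θ hθ => Or.inl (hfp θ hθ).ne'
    · exact hgqc.rpow_const fun θ hθ => Or.inl (hgq θ hθ).ne'
  have hae : k =ᵐ[volume.restrict (Ioo 0 1)] fun _ => 1 := by
    have h0 : (fun _ => (1 : ℝ≥0∞)) =ᵐ[volume.restrict (Ioo (0 : ℝ) 1)]
        fun θ => ENNReal.ofReal (k θ) := by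
      refine ae_eq_of_ae_le_of_lintegral_le ?_ (by simp) ?_ ?_
      · filter_upwards [ae_restrict_mem measurableSet_Ioo] with θ hθ
        rw [← ENNReal.ofReal_one]; exact ENNReal.ofReal_le_ofReal (hk1 θ hθ)
      · exact (hkc.aemeasurable measurableSet_Ioo).ennreal_ofReal
      · rw [hone]; exact hle.trans hle1
    filter_upwards [h0, ae_restrict_mem measurableSet_Ioo] with θ hθ hθ'
    have := (ENNReal.ofReal_eq_one).1 hθ.symm
    exact this
  have hkeq : EqOn k (fun _ => 1) (Ioo 0 1) :=
    Measure.eqOn_open_of_ae_eq hae isOpen_Ioo hkc continuousOn_const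
  -- The integrand `k` is continuous, so it equals 1 everywhere. Equality of the two means gives `f
  -- ∘ p = g ∘ q`, hence `p' = q'`.
  have hfg : ∀ θ ∈ Ioo (0 : ℝ) 1, f (p θ) = g (q θ) := by
    intro θ hθ
    have h1 : S' θ = (f (p θ))⁻¹ ^ (1 - μ) * (g (q θ))⁻¹ ^ μ := by
      have := (hkeq hθ).trans (hinvpow θ hθ).symm
      exact mul_right_cancel₀ (hprod θ hθ).ne' this
    exact inv_injective ((Real.geom_mean_eq_arith_mean2_weighted_iff_of_pos hμ1' hμ0
      (inv_pos.2 (hfp θ hθ)).le (inv_pos.2 (hgq θ hθ)).le (by ring)).1 h1.symm)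
  obtain ⟨e, he⟩ : ∃ e, ∀ θ ∈ Ioo (0 : ℝ) 1, q θ = p θ + e := by
    have hhalf : (1 / 2 : ℝ) ∈ Ioo (0 : ℝ) 1 := by norm_num
    refine ⟨q (1 / 2) - p (1 / 2), fun θ hθ => ?_⟩
    have hd : ∀ θ ∈ Ioo (0 : ℝ) 1, HasDerivAt (fun θ => q θ - p θ) 0 θ := by
      intro θ hθ
      have := (hqd θ hθ).sub (hpd θ hθ)
      rwa [hfg θ hθ, sub_self] at this
    have := isOpen_Ioo.is_const_of_deriv_eq_zero isPreconnected_Ioo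
      (f := fun θ => q θ - p θ) (fun θ hθ => (hd θ hθ).differentiableAt.differentiableWithinAt)
      (fun θ hθ => (hd θ hθ).deriv) hθ hhalf
    linarith
  have himg : Ioo c d = Ioo (a + e) (b + e) := by
    rw [← hqb.image_eq, image_congr he, ← image_add_const_Ioo, ← hpb.image_eq, image_image]
  have hlt : a + e < b + e := by linarith
  refine ⟨e, ?_, ?_, fun x hx => ?_⟩
  · have := congrArg sInf himg
    rwa [csInf_Ioo hcd, csInf_Ioo hlt] at this
  · have := congrArg sSup himg
    rwa [csSup_Ioo hcd, csSup_Ioo hlt] at this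
  · obtain ⟨θ, hθ, rfl⟩ := hpb.surjOn hx
    rw [← he θ hθ, hfg θ hθ]

/-! ### Slices of open convex sets and the regularity of their volumes. -/

section Sections
open scoped Pointwise

/-- The slice of a set at first coordinate `x`. -/
def coordSlice {m : ℕ} (U : Set (Fin (m + 1) → ℝ)) (x : ℝ) : Set (Fin m → ℝ) :=
  {y | (Fin.cons x y : Fin (m + 1) → ℝ) ∈ U}

theorem isOpen_coordSlice {m : ℕ} {U : Set (Fin (m + 1) → ℝ)} (hU : IsOpen U) (x : ℝ) :
    IsOpen (coordSlice U x) := by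
  refine hU.preimage (f := fun y : Fin m → ℝ => (Fin.cons x y : Fin (m + 1) → ℝ)) ?_
  exact continuous_const.finCons continuous_id

theorem combo_finCons {m : ℕ} (s t x x' : ℝ) (y y' : Fin m → ℝ) :
    (Fin.cons (s * x + t * x') (s • y + t • y') : Fin (m + 1) → ℝ) =
      s • (Fin.cons x y : Fin (m + 1) → ℝ) + t • (Fin.cons x' y' : Fin (m + 1) → ℝ) := by
  ext i
  refine Fin.cases ?_ (fun j => ?_) i <;> simp

theorem convex_coordSlice {m : ℕ} {U : Set (Fin (m + 1) → ℝ)} (hU : Convex ℝ U) (x : ℝ) :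
    Convex ℝ (coordSlice U x) := by
  intro y hy y' hy' s t hs ht hst
  have := combo_finCons s t x x y y'
  rw [← add_mul, hst, one_mul] at this
  simp only [coordSlice, mem_ofPred_eq] at *
  rw [this]
  exact hU hy hy' hs ht hst

theorem isBounded_coordSlice {m : ℕ} {U : Set (Fin (m + 1) → ℝ)} (hU : Bornology.IsBounded U)
    (x : ℝ) : Bornology.IsBounded (coordSlice U x) := by
  obtain ⟨R, hR⟩ := hU.exists_norm_le
  refine isBounded_iff_forall_norm_le.2 ⟨R, fun y hy => ?_⟩
  have h1 := hR _ hy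
  refine le_trans ?_ h1
  refine (pi_norm_le_iff_of_nonneg (norm_nonneg _)).2 fun i => ?_
  simpa using norm_le_pi_norm (Fin.cons x y : Fin (m + 1) → ℝ) i.succ

theorem combo_coordSlice_subset {m : ℕ} (U V : Set (Fin (m + 1) → ℝ)) (s t x x' : ℝ) :
    s • coordSlice U x + t • coordSlice V x' ⊆ coordSlice (s • U + t • V) (s * x + t * x') := by
  rintro _ ⟨_, ⟨y, hy, rfl⟩, _, ⟨y', hy', rfl⟩, rfl⟩
  simp only [coordSlice, mem_ofPred_eq]
  rw [combo_finCons]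
  exact add_mem_add (smul_mem_smul_set hy) (smul_mem_smul_set hy')

theorem preimage_piFinSuccAbove_symm {m : ℕ} (U : Set (Fin (m + 1) → ℝ)) (x : ℝ) :
    Prod.mk x ⁻¹' ((MeasurableEquiv.piFinSuccAbove (fun _ : Fin (m + 1) => ℝ) 0).symm ⁻¹' U) =
      coordSlice U x := by
  ext y
  simp only [mem_preimage, coordSlice, mem_ofPred_eq]
  rw [← Fin.insertNth_zero']
  rfl

theorem volume_eq_lintegral_coordSlice {m : ℕ} {U : Set (Fin (m + 1) → ℝ)}
    (hU : MeasurableSet U) : volume U = ∫⁻ x, volume (coordSlice U x) := by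
  have h := (volume_preserving_piFinSuccAbove (fun _ : Fin (m + 1) => ℝ) 0).symm
  rw [← h.measure_preimage hU.nullMeasurableSet, Measure.volume_eq_prod,
    Measure.prod_apply ((MeasurableEquiv.measurable _) hU)]
  refine lintegral_congr fun x => ?_
  rw [preimage_piFinSuccAbove_symm]

theorem exists_eq_Ioo_of_isOpen_convex {I : Set ℝ} (ho : IsOpen I) (hc : Convex ℝ I)
    (hb : Bornology.IsBounded I) (hne : I.Nonempty) : ∃ a b, a < b ∧ I = Ioo a b := by
  have h1 : Ioo (sInf I) (sSup I) ⊆ I :=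
    (show IsConnected I from ⟨hne, hc.isPreconnected⟩).Ioo_csInf_csSup_subset hb.bddBelow hb.bddAbove
  have h2 : I ⊆ Ioo (sInf I) (sSup I) := by
    rw [← interior_Icc]
    exact interior_maximal (subset_Icc_csInf_csSup hb.bddBelow hb.bddAbove) ho
  obtain ⟨x, hx⟩ := hne
  exact ⟨_, _, (h2 hx).1.trans (h2 hx).2, h2.antisymm h1⟩

theorem exists_coordSlice_nonempty_iff {m : ℕ} {U : Set (Fin (m + 1) → ℝ)} (ho : IsOpen U)
    (hc : Convex ℝ U) (hb : Bornology.IsBounded U) (hne : U.Nonempty) :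
    ∃ a b, a < b ∧ ∀ x, (coordSlice U x).Nonempty ↔ x ∈ Ioo a b := by
  obtain ⟨a, b, hab, h⟩ := exists_eq_Ioo_of_isOpen_convex
    (I := (fun y : Fin (m + 1) → ℝ => y 0) '' U)
    (isOpenMap_eval 0 _ ho)
    (hc.linear_image (LinearMap.proj 0 : (Fin (m + 1) → ℝ) →ₗ[ℝ] ℝ))
    (by
      obtain ⟨R, hR⟩ := hb.exists_norm_le
      refine isBounded_iff_forall_norm_le.2 ⟨R, ?_⟩
      rintro _ ⟨y, hy, rfl⟩
      exact (norm_le_pi_norm y 0).trans (hR y hy)) (hne.image _)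
  refine ⟨a, b, hab, fun x => ?_⟩
  rw [← h]
  constructor
  · rintro ⟨y, hy⟩
    exact ⟨_, hy, by simp⟩
  · rintro ⟨y, hy, rfl⟩
    refine ⟨Fin.tail y, ?_⟩
    simp only [coordSlice, mem_ofPred_eq, Fin.cons_self_tail]
    exact hy

/-- The multiplicative Brunn–Minkowski inequality for bounded open convex sets in `ℝ^m`. -/
def MultiplicativeBrunnMinkowski (m : ℕ) : Prop :=
  ∀ U V : Set (Fin m → ℝ), IsOpen U → Convex ℝ U → Bornology.IsBounded U → U.Nonempty →
    IsOpen V → Convex ℝ V → Bornology.IsBounded V → V.Nonempty → ∀ μ : ℝ, 0 < μ → μ < 1 →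
    ENNReal.ofReal (volume.real U ^ (1 - μ) * volume.real V ^ μ) ≤ volume ((1 - μ) • U + μ • V)

theorem measureReal_pos_of_isOpen_isBounded {m : ℕ} {U : Set (Fin m → ℝ)} (ho : IsOpen U)
    (hb : Bornology.IsBounded U) (hne : U.Nonempty) : 0 < volume.real U :=
  ENNReal.toReal_pos (ho.measure_pos volume hne).ne' hb.measure_lt_top.ne

/-- Brunn–Minkowski for the slices makes the slice volume log-concave, and a concave function on an
open interval is continuous. -/
theorem continuousOn_volume_coordSlice {m : ℕ} (hBM : MultiplicativeBrunnMinkowski m)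
    {U : Set (Fin (m + 1) → ℝ)} (ho : IsOpen U) (hc : Convex ℝ U) (hb : Bornology.IsBounded U)
    {a b : ℝ} (hI : ∀ x, (coordSlice U x).Nonempty ↔ x ∈ Ioo a b) :
    ContinuousOn (fun x => volume.real (coordSlice U x)) (Ioo a b) := by
  have hpos : ∀ x ∈ Ioo a b, 0 < volume.real (coordSlice U x) := fun x hx =>
    measureReal_pos_of_isOpen_isBounded (isOpen_coordSlice ho x) (isBounded_coordSlice hb x)
      ((hI x).2 hx)
  have hconc : ConcaveOn ℝ (Ioo a b) fun x => Real.log (volume.real (coordSlice U x)) := by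
    refine concaveOn_iff_forall_pos.2 ⟨convex_Ioo a b, fun x hx y hy s t hs ht hst => ?_⟩
    have hs' : s = 1 - t := by linarith
    subst hs'
    have h1 := hBM _ _ (isOpen_coordSlice ho x) (convex_coordSlice hc x)
      (isBounded_coordSlice hb x) ((hI x).2 hx) (isOpen_coordSlice ho y) (convex_coordSlice hc y)
      (isBounded_coordSlice hb y) ((hI y).2 hy) t ht (by linarith)
    have h2 : (1 - t) • coordSlice U x + t • coordSlice U y ⊆
        coordSlice U ((1 - t) * x + t * y) := by
      refine (combo_coordSlice_subset U U _ _ x y).trans ?_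
      intro z hz
      exact hc.set_combo_subset hs.le ht.le hst hz
    have h3 := h1.trans (measure_mono h2)
    rw [ENNReal.ofReal_le_iff_le_toReal (isBounded_coordSlice hb _).measure_lt_top.ne] at h3
    have h4 := Real.log_le_log (mul_pos (Real.rpow_pos_of_pos (hpos x hx) _)
      (Real.rpow_pos_of_pos (hpos y hy) _)) h3
    rw [Real.log_mul (Real.rpow_pos_of_pos (hpos x hx) _).ne'
      (Real.rpow_pos_of_pos (hpos y hy) _).ne', Real.log_rpow (hpos x hx),
      Real.log_rpow (hpos y hy)] at h4
    exact h4
  have := (hconc.continuousOn isOpen_Ioo).rexp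
  refine this.congr fun x hx => ?_
  simp only
  rw [Real.exp_log (hpos x hx)]
end Sections

/-! ### Brunn–Minkowski by induction on the dimension. -/

section Slices
open scoped Pointwise

theorem measurable_volume_coordSlice {m : ℕ} {U : Set (Fin (m + 1) → ℝ)}
    (hU : MeasurableSet U) : Measurable fun x => volume (coordSlice U x) := by
  have h := measurable_measure_prodMk_left (ν := (volume : Measure (Fin m → ℝ)))
    ((MeasurableEquiv.measurable (MeasurableEquiv.piFinSuccAbove
      (fun _ : Fin (m + 1) => ℝ) 0).symm) hU)
  simpa only [preimage_piFinSuccAbove_symm] using h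

theorem integrable_volume_coordSlice {m : ℕ} {U : Set (Fin (m + 1) → ℝ)}
    (hU : MeasurableSet U) (hfin : volume U ≠ ∞) :
    Integrable fun x => volume.real (coordSlice U x) :=
  integrable_toReal_of_lintegral_ne_top (measurable_volume_coordSlice hU).aemeasurable
    (by rwa [← volume_eq_lintegral_coordSlice hU])

theorem integral_volume_coordSlice {m : ℕ} {U : Set (Fin (m + 1) → ℝ)}
    (hU : MeasurableSet U) (hb : Bornology.IsBounded U) :
    ∫ x, volume.real (coordSlice U x) = volume.real U := by
  have := integral_toReal (μ := volume) (measurable_volume_coordSlice hU).aemeasurable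
    (Filter.Eventually.of_forall fun x => (isBounded_coordSlice hb x).measure_lt_top)
  rw [← volume_eq_lintegral_coordSlice hU] at this
  exact this

/-- The slicing step: the multiplicative Brunn–Minkowski inequality passes from dimension `m` to
`m + 1`, and in the case of equality the normalized slice volumes are translates of each other. -/
theorem brunnMinkowski_of_slices {m : ℕ} (hBM : MultiplicativeBrunnMinkowski m)
    {U V : Set (Fin (m + 1) → ℝ)} (hUo : IsOpen U) (hUc : Convex ℝ U)
    (hUb : Bornology.IsBounded U) (hUn : U.Nonempty) (hVo : IsOpen V) (hVc : Convex ℝ V)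
    (hVb : Bornology.IsBounded V) (hVn : V.Nonempty) {μ : ℝ} (hμ0 : 0 < μ) (hμ1 : μ < 1) :
    ENNReal.ofReal (volume.real U ^ (1 - μ) * volume.real V ^ μ) ≤
        volume ((1 - μ) • U + μ • V) ∧
      (volume ((1 - μ) • U + μ • V) ≤
          ENNReal.ofReal (volume.real U ^ (1 - μ) * volume.real V ^ μ) →
        ∃ e, ∀ x, volume.real (coordSlice V (x + e)) / volume.real V =
          volume.real (coordSlice U x) / volume.real U) := by
  have hμ1' : 0 < 1 - μ := by linarith
  have hA := measureReal_pos_of_isOpen_isBounded hUo hUb hUn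
  have hB := measureReal_pos_of_isOpen_isBounded hVo hVb hVn
  set A := volume.real U with hAdef
  set B := volume.real V with hBdef
  have hAμ := Real.rpow_pos_of_pos hA (1 - μ)
  have hBμ := Real.rpow_pos_of_pos hB μ
  set W := (1 - μ) • U + μ • V with hW
  have hWo : IsOpen W := (hVo.smul₀ hμ0.ne').add_left
  obtain ⟨a, b, hab, hI⟩ := exists_coordSlice_nonempty_iff hUo hUc hUb hUn
  obtain ⟨c, d, hcd, hJ⟩ := exists_coordSlice_nonempty_iff hVo hVc hVb hVn
  have hfpos : ∀ x ∈ Ioo a b, 0 < volume.real (coordSlice U x) := fun x hx =>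
    measureReal_pos_of_isOpen_isBounded (isOpen_coordSlice hUo x) (isBounded_coordSlice hUb x)
      ((hI x).2 hx)
  have hgpos : ∀ x ∈ Ioo c d, 0 < volume.real (coordSlice V x) := fun x hx =>
    measureReal_pos_of_isOpen_isBounded (isOpen_coordSlice hVo x) (isBounded_coordSlice hVb x)
      ((hJ x).2 hx)
  have hf0 : ∀ x, x ∉ Ioo a b → volume.real (coordSlice U x) = 0 := fun x hx => by
    rw [not_nonempty_iff_eq_empty.1 fun h => hx ((hI x).1 h), measureReal_empty]
  have hg0 : ∀ x, x ∉ Ioo c d → volume.real (coordSlice V x) = 0 := fun x hx => by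
    rw [not_nonempty_iff_eq_empty.1 fun h => hx ((hJ x).1 h), measureReal_empty]
  set C := ENNReal.ofReal (A ^ (1 - μ) * B ^ μ) with hC
  have hC0 : C ≠ 0 := (ENNReal.ofReal_pos.2 (mul_pos hAμ hBμ)).ne'
  have hCt : C ≠ ∞ := ENNReal.ofReal_ne_top
  have key := prekopa_leindler_real hab hcd
    (f := fun x => volume.real (coordSlice U x) / A)
    (g := fun x => volume.real (coordSlice V x) / B)
    ((continuousOn_volume_coordSlice hBM hUo hUc hUb hI).div_const _)
    ((continuousOn_volume_coordSlice hBM hVo hVc hVb hJ).div_const _)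
    (fun x hx => div_pos (hfpos x hx) hA) (fun x hx => div_pos (hgpos x hx) hB)
    ((integrable_volume_coordSlice hUo.measurableSet hUb.measure_lt_top.ne).div_const
      _).integrableOn
    ((integrable_volume_coordSlice hVo.measurableSet hVb.measure_lt_top.ne).div_const
      _).integrableOn
    (by
      rw [integral_div, setIntegral_eq_integral_of_forall_compl_eq_zero hf0,
        integral_volume_coordSlice hUo.measurableSet hUb, div_self hA.ne'])
    (by
      rw [integral_div, setIntegral_eq_integral_of_forall_compl_eq_zero hg0,
        integral_volume_coordSlice hVo.measurableSet hVb, div_self hB.ne'])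
    -- Dividing by `C` matches the normalization of `f` and `g` to densities, so `1 ≤ ∫ h` is the
    -- inequality sought.
    hμ0 hμ1 (h := fun x => volume (coordSlice W x) * C⁻¹)
    (by
      intro x hx y hy
      have h1 := (hBM _ _ (isOpen_coordSlice hUo x) (convex_coordSlice hUc x)
        (isBounded_coordSlice hUb x) ((hI x).2 hx) (isOpen_coordSlice hVo y)
        (convex_coordSlice hVc y) (isBounded_coordSlice hVb y) ((hJ y).2 hy) μ hμ0 hμ1).trans
        (measure_mono (combo_coordSlice_subset U V _ _ x y))
      rw [Real.div_rpow (hfpos x hx).le hA.le, Real.div_rpow (hgpos y hy).le hB.le,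
        div_mul_div_comm, ENNReal.ofReal_div_of_pos (mul_pos hAμ hBμ), ENNReal.div_eq_inv_mul,
        mul_comm]
      gcongr)
  rw [lintegral_mul_const' _ _ (ENNReal.inv_ne_top.2 hC0),
    ← volume_eq_lintegral_coordSlice hWo.measurableSet, ← div_eq_mul_inv] at key
  refine ⟨by simpa [ENNReal.le_div_iff_mul_le (Or.inl hC0) (Or.inl hCt)] using key.1,
    fun hle => ?_⟩
  obtain ⟨e, hca, hdb, he⟩ := key.2 (ENNReal.div_le_of_le_mul (by rwa [one_mul]))
  refine ⟨e, fun x => ?_⟩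
  by_cases hx : x ∈ Ioo a b
  · exact he x hx
  · rw [hf0 x hx, hg0, zero_div, zero_div]
    rintro ⟨h1, h2⟩
    exact hx ⟨by linarith, by linarith⟩

theorem multiplicativeBrunnMinkowski (m : ℕ) : MultiplicativeBrunnMinkowski m := by
  induction m with
  | zero =>
    intro U V _ _ _ hU _ _ _ hV μ _ _
    have hU' : U = univ := Subsingleton.eq_univ_of_nonempty hU
    have hV' : V = univ := Subsingleton.eq_univ_of_nonempty hV
    have hW : (1 - μ) • U + μ • V = univ :=
      Subsingleton.eq_univ_of_nonempty ((hU.smul_set).add hV.smul_set)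
    rw [hW, hU', hV']
    simp [Measure.real, volume_pi]
  | succ m ih =>
    intro U V hUo hUc hUb hUn hVo hVc hVb hVn μ hμ0 hμ1
    exact (brunnMinkowski_of_slices ih hUo hUc hUb hUn hVo hVc hVb hVn hμ0 hμ1).1

end Slices

/-! ### Equality in Brunn–Minkowski for sets of equal volume. -/

section EqualityCase
open scoped Pointwise

/-- In the equality case of the Brunn–Minkowski inequality for sets of the same volume, the
marginals of the two sets along the first coordinate are translates of each other. -/
theorem exists_marginal_translate_pi {m : ℕ} {U V : Set (Fin (m + 1) → ℝ)} (hUo : IsOpen U)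
    (hUc : Convex ℝ U) (hUb : Bornology.IsBounded U) (hUn : U.Nonempty) (hVo : IsOpen V)
    (hVc : Convex ℝ V) (hVb : Bornology.IsBounded V) (hVn : V.Nonempty) {μ : ℝ} (hμ0 : 0 < μ)
    (hμ1 : μ < 1) (hUV : volume V = volume U)
    (hle : volume ((1 - μ) • U + μ • V) ≤ volume U) :
    ∃ e : ℝ, ∀ s : Set ℝ, MeasurableSet s →
      volume (V ∩ (fun y => y 0) ⁻¹' s) = volume (U ∩ (fun y => y 0 + e) ⁻¹' s) := by
  have hA := measureReal_pos_of_isOpen_isBounded hUo hUb hUn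
  have hUV' : volume.real V = volume.real U := congrArg ENNReal.toReal hUV
  obtain ⟨e, he⟩ := (brunnMinkowski_of_slices (multiplicativeBrunnMinkowski m) hUo hUc hUb hUn
    hVo hVc hVb hVn hμ0 hμ1).2 (by
      rw [hUV', ← Real.rpow_add hA, sub_add_cancel, Real.rpow_one]
      rwa [Measure.real, ENNReal.ofReal_toReal hUb.measure_lt_top.ne])
  have hslice : ∀ x, volume (coordSlice V (x + e)) = volume (coordSlice U x) := by
    intro x
    have := he x
    rw [hUV', div_left_inj' hA.ne'] at this
    exact (ENNReal.toReal_eq_toReal_iff' (isBounded_coordSlice hVb _).measure_lt_top.ne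
      (isBounded_coordSlice hUb _).measure_lt_top.ne).1 this
  have hinter : ∀ (W : Set (Fin (m + 1) → ℝ)) (s : Set ℝ) (x : ℝ),
      volume (coordSlice (W ∩ (fun y => y 0) ⁻¹' s) x) =
        s.indicator (fun x => volume (coordSlice W x)) x := by
    intro W s x
    by_cases hx : x ∈ s
    · rw [indicator_of_mem hx]
      congr 1
      ext y
      simp [coordSlice, hx]
    · rw [indicator_of_notMem hx]
      convert measure_empty (μ := volume)
      ext y
      simp [coordSlice, hx]
  refine ⟨e, fun s hs => ?_⟩
  have hs' : MeasurableSet ((fun x : ℝ => x + e) ⁻¹' s) := (measurable_add_const e) hs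
  have h0 : Measurable fun y : Fin (m + 1) → ℝ => y 0 := measurable_pi_apply 0
  rw [volume_eq_lintegral_coordSlice (hVo.measurableSet.inter (h0 hs)),
    volume_eq_lintegral_coordSlice (U := U ∩ (fun y => y 0 + e) ⁻¹' s)
      (hUo.measurableSet.inter (h0 hs'))]
  rw [← lintegral_add_right_eq_self _ e]
  refine lintegral_congr fun x => ?_
  rw [hinter V s, show (fun y : Fin (m + 1) → ℝ => y 0 + e) ⁻¹' s =
    (fun y => y 0) ⁻¹' ((fun x => x + e) ⁻¹' s) from rfl, hinter U]
  simp only [indicator, hslice]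
  rfl

/-- The coordinate version transported to an arbitrary direction `u`. -/
theorem exists_marginal_translate {n : ℕ} {U V : Set (EuclideanSpace ℝ (Fin n))} (hUo : IsOpen U)
    (hUc : Convex ℝ U) (hUb : Bornology.IsBounded U) (hUn : U.Nonempty) (hVo : IsOpen V)
    (hVc : Convex ℝ V) (hVb : Bornology.IsBounded V) (hVn : V.Nonempty) {μ : ℝ} (hμ0 : 0 < μ)
    (hμ1 : μ < 1) (hUV : volume V = volume U)
    (hle : volume ((1 - μ) • U + μ • V) ≤ volume U)
    {u : EuclideanSpace ℝ (Fin n)} (hu : u ≠ 0) :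
    ∃ e : ℝ, ∀ s : Set ℝ, MeasurableSet s →
      volume (V ∩ (fun y => inner ℝ u y) ⁻¹' s) = volume (U ∩ (fun y => inner ℝ u y + e) ⁻¹' s) := by
  obtain _ | m := n
  · exact absurd (Subsingleton.elim u 0) hu
  set w : EuclideanSpace ℝ (Fin (m + 1)) := EuclideanSpace.single 0 ‖u‖ with hw
  have hnorm : ‖u‖ = ‖w‖ := by simp [hw]
  -- The reflection taking `u` to a multiple of the first basis vector reduces to the first
  -- coordinate.
  set R : EuclideanSpace ℝ (Fin (m + 1)) ≃ₗᵢ[ℝ] EuclideanSpace ℝ (Fin (m + 1)) :=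
    (ℝ ∙ (u - w))ᗮ.reflection with hR
  have hRu : R u = w := Submodule.reflection_sub hnorm
  set Φ : EuclideanSpace ℝ (Fin (m + 1)) ≃L[ℝ] (Fin (m + 1) → ℝ) :=
    R.toContinuousLinearEquiv.trans (EuclideanSpace.equiv (Fin (m + 1)) ℝ) with hΦ
  have hΦ0 : ∀ x, inner ℝ u x = ‖u‖ * Φ x 0 := by
    intro x
    rw [← R.inner_map_map, hRu, hw, EuclideanSpace.inner_single_left]
    simp [hΦ]
  have hmp : MeasurePreserving Φ :=
    (PiLp.volume_preserving_ofLp (Fin (m + 1))).comp R.measurePreserving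
  have hvol : ∀ W, MeasurableSet W → volume (Φ '' W) = volume W := by
    intro W hW
    have himg : MeasurableSet (Φ '' W) := by
      rw [Φ.image_eq_preimage_symm]; exact Φ.symm.continuous.measurable hW
    rw [← hmp.measure_preimage himg.nullMeasurableSet, preimage_image_eq _ Φ.injective]
  have hWo : IsOpen ((1 - μ) • U + μ • V) := (hVo.smul₀ hμ0.ne').add_left
  have himage : ∀ W, IsOpen W → IsOpen (Φ '' W) := fun W hW => Φ.toHomeomorph.isOpenMap _ hW
  have hbdd : ∀ W, Bornology.IsBounded W → Bornology.IsBounded (Φ '' W) := fun W hW =>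
    (Φ : EuclideanSpace ℝ (Fin (m + 1)) →L[ℝ] (Fin (m + 1) → ℝ)).lipschitz.isBounded_image hW
  obtain ⟨e, he⟩ := exists_marginal_translate_pi (himage U hUo)
    (hUc.linear_image (Φ : EuclideanSpace ℝ (Fin (m + 1)) →ₗ[ℝ] (Fin (m + 1) → ℝ)))
    (hbdd U hUb) (hUn.image _) (himage V hVo)
    (hVc.linear_image (Φ : EuclideanSpace ℝ (Fin (m + 1)) →ₗ[ℝ] (Fin (m + 1) → ℝ)))
    (hbdd V hVb) (hVn.image _) hμ0 hμ1
    (by rw [hvol V hVo.measurableSet, hvol U hUo.measurableSet, hUV])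
    (by
      rw [← image_smul_set, ← image_smul_set, ← image_add, hvol _ hWo.measurableSet,
        hvol U hUo.measurableSet]
      exact hle)
  refine ⟨‖u‖ * e, fun s hs => ?_⟩
  have h1 := he ((fun t => ‖u‖ * t) ⁻¹' s) ((measurable_const_mul ‖u‖) hs)
  have hpre : ∀ (W : Set (EuclideanSpace ℝ (Fin (m + 1)))) (t : Set (Fin (m + 1) → ℝ)),
      volume (Φ '' W ∩ t) = volume (W ∩ Φ ⁻¹' t) := by
    intro W t
    have h := Φ.toHomeomorph.toMeasurableEquiv.measurableEmbedding
    rw [← image_inter_preimage, ← hmp.measure_preimage_emb h, preimage_image_eq _ Φ.injective]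
  rw [hpre, hpre] at h1
  convert h1 using 3
  · ext x
    simp [hΦ0]
  · ext x
    simp [hΦ0, mul_add]

/-- If `y - v ∉ U`, a separating functional `u` leaves `U + v` no mass beyond level `⟨u, y⟩`,
whereas the open set `V` contains `y + ε u` beyond it. -/
theorem subset_translate_of_marginals {n : ℕ} {U V : Set (EuclideanSpace ℝ (Fin n))}
    (hUo : IsOpen U) (hUc : Convex ℝ U) (hUn : U.Nonempty) (hVo : IsOpen V)
    {v : EuclideanSpace ℝ (Fin n)}
    (h : ∀ u : EuclideanSpace ℝ (Fin n), u ≠ 0 → ∀ c : ℝ,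
      volume (V ∩ (fun y => inner ℝ u y) ⁻¹' Ioi c) =
        volume (U ∩ (fun y => inner ℝ u (y + v)) ⁻¹' Ioi c)) :
    ∀ y ∈ V, y - v ∈ U := by
  intro y hy
  by_contra hyU
  obtain ⟨f, hf⟩ := geometric_hahn_banach_open_point hUc hUo hyU
  set u := (InnerProductSpace.toDual ℝ (EuclideanSpace ℝ (Fin n))).symm f with hu
  have hfu : ∀ x, inner ℝ u x = f x := fun x =>
    InnerProductSpace.toDual_symm_apply
  have hu0 : u ≠ 0 := by
    rintro h0
    obtain ⟨x, hx⟩ := hUn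
    have := hf x hx
    rw [← hfu, ← hfu, h0, inner_zero_left, inner_zero_left] at this
    exact lt_irrefl _ this
  have h1 := h u hu0 (f y)
  have h2 : U ∩ (fun y => inner ℝ u (y + v)) ⁻¹' Ioi (f y) = ∅ := by
    ext x
    simp only [mem_inter_iff, mem_preimage, mem_Ioi, mem_empty_iff_false, iff_false, not_and,
      not_lt]
    intro hx
    have := hf x hx
    rw [map_sub] at this
    rw [hfu, map_add]
    linarith
  rw [h2, measure_empty] at h1
  have h3 : IsOpen (V ∩ (fun y => inner ℝ u y) ⁻¹' Ioi (f y)) :=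
    hVo.inter (isOpen_Ioi.preimage (by fun_prop))
  have h4 := (h3.measure_eq_zero_iff volume).1 h1
  have h5 : ∀ᶠ ε : ℝ in nhdsWithin 0 (Ioi 0), y + ε • u ∈ V := by
    have hc : ContinuousAt (fun ε : ℝ => y + ε • u) 0 := by fun_prop
    exact nhdsWithin_le_nhds (hc.preimage_mem_nhds (hVo.mem_nhds (by simpa using hy)))
  obtain ⟨ε, hε, hε0⟩ := (h5.and self_mem_nhdsWithin).exists
  refine (eq_empty_iff_forall_notMem.1 h4) (y + ε • u) ⟨hε, ?_⟩
  have hε0' : 0 < ε := hε0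
  have hun : 0 < inner ℝ u u := real_inner_self_pos.2 hu0
  simp only [mem_preimage, mem_Ioi, inner_add_right, inner_smul_right, hfu y]
  nlinarith

/-- Equality in the Brunn–Minkowski inequality for bounded open convex sets of the same volume
forces the sets to be translates of each other. -/
theorem exists_translate_of_brunnMinkowski_eq {n : ℕ} {U V : Set (EuclideanSpace ℝ (Fin n))}
    (hUo : IsOpen U) (hUc : Convex ℝ U) (hUb : Bornology.IsBounded U) (hUn : U.Nonempty)
    (hVo : IsOpen V) (hVc : Convex ℝ V) (hVb : Bornology.IsBounded V) (hVn : V.Nonempty) {μ : ℝ}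
    (hμ0 : 0 < μ) (hμ1 : μ < 1) (hUV : volume V = volume U)
    (hle : volume ((1 - μ) • U + μ • V) ≤ volume U) :
    ∃ v, ∀ y, y ∈ V ↔ y - v ∈ U := by
  have hA : 0 < volume.real U :=
    ENNReal.toReal_pos (hUo.measure_pos volume hUn).ne' hUb.measure_lt_top.ne
  have hint : ∀ W : Set (EuclideanSpace ℝ (Fin n)), Bornology.IsBounded W →
      IntegrableOn (fun x => x) W := by
    intro W hW
    obtain ⟨R, hR⟩ := hW.subset_closedBall 0
    exact (continuous_id'.continuousOn.integrableOn_compact (isCompact_closedBall 0 R)).mono_set hR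
  -- The difference of the centroids, as the volumes agree. Comparing the means of the marginals
  -- identifies the shift in each direction `u` as `⟨u, v⟩`, with one `v` for all `u`.
  set v : EuclideanSpace ℝ (Fin n) :=
    (volume.real U)⁻¹ • ((∫ x in V, x) - ∫ x in U, x) with hv
  have key : ∀ u : EuclideanSpace ℝ (Fin n), u ≠ 0 → ∀ s : Set ℝ, MeasurableSet s →
      volume (V ∩ (fun y => inner ℝ u y) ⁻¹' s) =
        volume (U ∩ (fun y => inner ℝ u y + inner ℝ u v) ⁻¹' s) := by
    intro u hu
    obtain ⟨e, he⟩ := exists_marginal_translate hUo hUc hUb hUn hVo hVc hVb hVn hμ0 hμ1 hUV hle hu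
    have hm : Measurable fun x : EuclideanSpace ℝ (Fin n) => inner ℝ u x := by fun_prop
    have hme : Measurable fun x : EuclideanSpace ℝ (Fin n) => inner ℝ u x + e := by fun_prop
    have hmap : (volume.restrict V).map (fun y => inner ℝ u y) =
        (volume.restrict U).map (fun y => inner ℝ u y + e) := by
      ext s hs
      rw [Measure.map_apply hm hs, Measure.map_apply hme hs, Measure.restrict_apply (hm hs),
        Measure.restrict_apply (hme hs), inter_comm, he s hs, inter_comm]
    have h1 : ∫ t, t ∂((volume.restrict V).map (fun y => inner ℝ u y)) =
        inner ℝ u (∫ x in V, x) := by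
      rw [integral_map hm.aemeasurable measurable_id'.aestronglyMeasurable, integral_inner (hint V hVb)]
    have h2 : ∫ t, t ∂((volume.restrict U).map (fun y => inner ℝ u y + e)) =
        inner ℝ u (∫ x in U, x) + volume.real U * e := by
      rw [integral_map hme.aemeasurable measurable_id'.aestronglyMeasurable,
        integral_add ((hint U hUb).const_inner u) (by
          have : IsFiniteMeasure (volume.restrict U) :=
            isFiniteMeasure_restrict.2 hUb.measure_lt_top.ne
          exact integrable_const e), integral_inner (hint U hUb)]
      simp
    have hev : e = inner ℝ u v := by
      rw [hmap, h2] at h1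
      rw [hv, inner_smul_right, inner_sub_right, ← h1]
      field_simp
      ring
    rwa [← hev]
  refine ⟨v, fun y => ⟨fun hy => ?_, fun hy => ?_⟩⟩
  · refine subset_translate_of_marginals hUo hUc hUn hVo (fun u hu c => ?_) y hy
    simpa only [inner_add_right] using key u hu _ measurableSet_Ioi
  · have := subset_translate_of_marginals (v := -v) hVo hVc hVn hUo (fun u hu c => ?_) _ hy
    · simpa using this
    · have h := key u hu (Ioi (c + inner ℝ u v)) measurableSet_Ioi
      convert h.symm using 3
      · ext x; simp
      · ext x
        simp only [mem_preimage, mem_Ioi, inner_add_right, inner_neg_right]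
        constructor <;> intro h <;> linarith

end EqualityCase

/-! ### Equality in Brunn–Minkowski for closed convex sets of arbitrary volumes. -/

section ConvexGeometry
open scoped Pointwise

variable {n : ℕ}

theorem Convex.volume_interior {D : Set (EuclideanSpace ℝ (Fin n))} (hD : Convex ℝ D) :
    volume (interior D) = volume D := by
  refine le_antisymm (measure_mono interior_subset) ?_
  calc volume D ≤ volume (interior D ∪ frontier D) := by
        refine measure_mono ?_
        rw [← closure_eq_interior_union_frontier]; exact subset_closure
    _ ≤ volume (interior D) + volume (frontier D) := measure_union_le _ _
    _ = volume (interior D) := by rw [hD.addHaar_frontier volume, add_zero]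

theorem Convex.interior_nonempty_of_volume_ne_zero {D : Set (EuclideanSpace ℝ (Fin n))}
    (hD : Convex ℝ D) (h0 : volume D ≠ 0) : (interior D).Nonempty := by
  rw [← hD.volume_interior] at h0
  exact nonempty_of_measure_ne_zero h0

/-- A ball in `D` and a far point of `D` span a cone whose half near the ball contains arbitrarily
many disjoint balls of half the radius. -/
theorem Convex.isBounded_of_volume_ne_top {D : Set (EuclideanSpace ℝ (Fin n))}
    (hD : Convex ℝ D) (hne : (interior D).Nonempty) (hfin : volume D ≠ ∞) :
    Bornology.IsBounded D := by
  obtain ⟨c, hc⟩ := hne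
  obtain ⟨δ, hδ, hball⟩ := Metric.isOpen_iff.1 isOpen_interior c hc
  have hball' : Metric.ball c δ ⊆ D := hball.trans interior_subset
  by_contra hb
  have hfar : ∀ R : ℝ, ∃ x ∈ D, R < ‖x - c‖ := by
    intro R
    by_contra! h
    exact hb ((Metric.isBounded_closedBall (x := c) (r := R)).subset fun x hx => by
      rw [mem_closedBall_iff_norm]; exact h x hx)
  have hle : ∀ N : ℕ, (N : ℝ≥0∞) * volume (Metric.ball (0 : EuclideanSpace ℝ (Fin n)) (δ / 2)) ≤
      volume D := by
    intro N
    obtain rfl | hN := Nat.eq_zero_or_pos N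
    · simp
    have hN' : (0 : ℝ) < N := Nat.cast_pos.2 hN
    -- At this distance the `N` centres `z j`, all in the first half of the segment from `c` to `x`,
    -- are at least `δ` apart.
    obtain ⟨x, hx, hxR⟩ := hfar (2 * N * δ)
    set z : ℕ → EuclideanSpace ℝ (Fin n) := fun j => c + ((j : ℝ) / (2 * N)) • (x - c) with hz
    have hdisj : (↑(Finset.range N) : Set ℕ).PairwiseDisjoint
        fun j => Metric.ball (z j) (δ / 2) := by
      intro j _ k _ hjk
      refine Metric.ball_disjoint_ball ?_
      have h1 : (1 : ℝ) ≤ |(j : ℝ) - k| := by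
        have : (1 : ℤ) ≤ |(j : ℤ) - k| := Int.one_le_abs (by omega)
        exact_mod_cast this
      have h2 : dist (z j) (z k) = |(j : ℝ) - k| * (‖x - c‖ / (2 * N)) := by
        rw [dist_eq_norm, hz]
        simp only
        rw [add_sub_add_left_eq_sub, ← sub_smul, ← sub_div, norm_smul, Real.norm_eq_abs, abs_div,
          abs_of_pos (by positivity : (0 : ℝ) < 2 * N)]
        ring
      have h3 : δ ≤ ‖x - c‖ / (2 * N) := by
        rw [le_div_iff₀ (by positivity)]; linarith
      rw [h2]
      nlinarith
    have hsub : ∀ j ∈ Finset.range N, Metric.ball (z j) (δ / 2) ⊆ D := by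
      intro j hj y hy
      have hjN : (j : ℝ) < N := Nat.cast_lt.2 (Finset.mem_range.1 hj)
      set τ : ℝ := (j : ℝ) / (2 * N) with hτ
      have hτ0 : 0 ≤ τ := by positivity
      have hτ1 : τ ≤ 1 / 2 := by
        rw [hτ, div_le_iff₀ (by positivity)]; linarith
      have hτ2 : 0 < 1 - τ := by linarith
      have hmem : c + (1 - τ)⁻¹ • (y - z j) ∈ D := by
        apply hball'
        rw [mem_ball_iff_norm] at hy ⊢
        rw [add_sub_cancel_left, norm_smul, norm_inv, Real.norm_of_nonneg hτ2.le,
          inv_mul_lt_iff₀ hτ2]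
        nlinarith
      have h := hD hmem hx hτ2.le hτ0 (by ring)
      have h' : (1 - τ) • (c + (1 - τ)⁻¹ • (y - z j)) + τ • x = y := by
        rw [smul_add, smul_smul, mul_inv_cancel₀ hτ2.ne', hz]
        module
      rwa [h'] at h
    calc (N : ℝ≥0∞) * volume (Metric.ball (0 : EuclideanSpace ℝ (Fin n)) (δ / 2))
        = ∑ j ∈ Finset.range N, volume (Metric.ball (z j) (δ / 2)) := by
          simp [Measure.addHaar_ball_center]
      _ = volume (⋃ j ∈ Finset.range N, Metric.ball (z j) (δ / 2)) :=
          (measure_biUnion_finset hdisj fun _ _ => measurableSet_ball).symm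
      _ ≤ volume D := measure_mono (iUnion₂_subset hsub)
  have hpos : volume (Metric.ball (0 : EuclideanSpace ℝ (Fin n)) (δ / 2)) ≠ 0 :=
    (Metric.measure_ball_pos _ _ (by positivity)).ne'
  have hfinb : volume (Metric.ball (0 : EuclideanSpace ℝ (Fin n)) (δ / 2)) ≠ ∞ :=
    measure_ball_lt_top.ne
  obtain ⟨N, hN⟩ := ENNReal.exists_nat_mul_gt hpos hfin
  exact absurd (hle N) (not_le.2 hN)

theorem Convex.subset_of_volume_le {P Q : Set (EuclideanSpace ℝ (Fin n))} (hQ : Convex ℝ Q)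
    (hP : IsClosed P) (hPQ : P ⊆ Q) (hfin : volume P ≠ ∞) (hle : volume Q ≤ volume P)
    (hne : (interior Q).Nonempty) : Q ⊆ P := by
  have h0 : volume (Q \ P) = 0 := by
    rw [measure_sdiff hPQ hP.measurableSet.nullMeasurableSet hfin]
    exact tsub_eq_zero_of_le hle
  have h1 : interior Q \ P = ∅ :=
    ((isOpen_interior.sdiff hP).measure_eq_zero_iff volume).1
      (measure_mono_null (sdiff_subset_sdiff_left interior_subset) h0)
  calc Q ⊆ closure (interior Q) := by
        rw [hQ.closure_interior_eq_closure_of_nonempty_interior hne]; exact subset_closure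
    _ ⊆ P := closure_minimal (sdiff_eq_empty.1 h1) hP

/-- Equality in the Brunn–Minkowski inequality for closed convex sets of positive finite volume
forces the sets to be homothetic. -/
theorem exists_homothety_of_brunnMinkowski_eq {D D' M : Set (EuclideanSpace ℝ (Fin n))}
    (hDc : Convex ℝ D) (hD : IsClosed D) (hDc' : Convex ℝ D') (hD' : IsClosed D') {r r' t : ℝ}
    (hr : 0 < r) (hr' : 0 < r') (ht0 : 0 < t) (ht1 : t < 1)
    (hv : volume D = ENNReal.ofReal (r ^ n)) (hv' : volume D' = ENNReal.ofReal (r' ^ n))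
    (hM : (1 - t) • D + t • D' ⊆ M)
    (hvM : volume M = ENNReal.ofReal (((1 - t) * r + t * r') ^ n)) :
    ∃ v, ∀ x, x ∈ D ↔ (r' / r) • x + v ∈ D' := by
  have ht1' : 0 < 1 - t := by linarith
  have hpos : ∀ {s : ℝ}, 0 < s → ENNReal.ofReal (s ^ n) ≠ 0 := fun hs =>
    (ENNReal.ofReal_pos.2 (pow_pos hs n)).ne'
  have hscale : ∀ {s : ℝ} {X : Set (EuclideanSpace ℝ (Fin n))}, 0 < s →
      volume X = ENNReal.ofReal (s ^ n) → volume (s⁻¹ • X) = 1 := by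
    intro s X hs hX
    rw [Measure.addHaar_smul, hX, finrank_euclideanSpace_fin, ← ENNReal.ofReal_mul (abs_nonneg _),
      abs_of_pos (by positivity), ← mul_pow, inv_mul_cancel₀ hs.ne', one_pow, ENNReal.ofReal_one]
  have hiD := hDc.interior_nonempty_of_volume_ne_zero (hv ▸ hpos hr)
  have hiD' := hDc'.interior_nonempty_of_volume_ne_zero (hv' ▸ hpos hr')
  have hbD := hDc.isBounded_of_volume_ne_top hiD (hv ▸ ENNReal.ofReal_ne_top)
  have hbD' := hDc'.isBounded_of_volume_ne_top hiD' (hv' ▸ ENNReal.ofReal_ne_top)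
  set m : ℝ := (1 - t) * r + t * r' with hm
  have hm0 : 0 < m := by positivity
  -- This weight makes the combination of the normalized sets `D / r` and `D' / r'` equal to `((1-t)
  -- D + t D') / m`.
  set μ : ℝ := t * r' / m with hμ
  have hμ' : 1 - μ = (1 - t) * r / m := by
    rw [hμ, eq_div_iff hm0.ne', sub_mul, div_mul_cancel₀ _ hm0.ne', hm]; ring
  have hμ0 : 0 < μ := by positivity
  have hμ1 : μ < 1 := by
    have : 0 < 1 - μ := by rw [hμ']; positivity
    linarith
  have hri : r⁻¹ ≠ 0 := (inv_pos.2 hr).ne'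
  have hri' : r'⁻¹ ≠ 0 := (inv_pos.2 hr').ne'
  have hU1 : volume (r⁻¹ • interior D) = 1 := hscale hr (by rw [hDc.volume_interior, hv])
  have hV1 : volume (r'⁻¹ • interior D') = 1 := hscale hr' (by rw [hDc'.volume_interior, hv'])
  have hsub : (1 - μ) • r⁻¹ • interior D + μ • r'⁻¹ • interior D' ⊆ m⁻¹ • M := by
    have h1 : (1 - μ) * r⁻¹ = m⁻¹ * (1 - t) := by rw [hμ']; field_simp
    have h2 : μ * r'⁻¹ = m⁻¹ * t := by rw [hμ]; field_simp
    rw [smul_smul, smul_smul, h1, h2, ← smul_smul, ← smul_smul, ← smul_add]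
    exact smul_set_mono ((add_subset_add (smul_set_mono interior_subset)
      (smul_set_mono interior_subset)).trans hM)
  obtain ⟨v, hvv⟩ := exists_translate_of_brunnMinkowski_eq (isOpen_interior.smul₀ hri)
    (hDc.interior.smul _) ((hbD.subset interior_subset).smul₀ _) hiD.smul_set
    (isOpen_interior.smul₀ hri') (hDc'.interior.smul _) ((hbD'.subset interior_subset).smul₀ _)
    hiD'.smul_set hμ0 hμ1 (hV1.trans hU1.symm)
    ((measure_mono hsub).trans (by rw [hscale hm0 hvM, hU1]))
  have hρ : r' / r ≠ 0 := (div_pos hr' hr).ne'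
  set ψ : EuclideanSpace ℝ (Fin n) ≃ₜ EuclideanSpace ℝ (Fin n) :=
    (Homeomorph.smulOfNeZero (r' / r) hρ).trans (Homeomorph.addRight (r' • v)) with hψ
  have hψx : ∀ x, ψ x = (r' / r) • x + r' • v := fun x => rfl
  have hint : interior D = ψ ⁻¹' interior D' := by
    ext x
    have h := hvv (r'⁻¹ • ψ x)
    rw [smul_mem_smul_set_iff₀ hri', hψx, smul_add, smul_smul, smul_smul,
      inv_mul_cancel₀ hr'.ne', one_smul, add_sub_cancel_right,
      show r'⁻¹ * (r' / r) = r⁻¹ by field_simp, smul_mem_smul_set_iff₀ hri] at h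
    rw [mem_preimage, hψx, h]
  have hcl : D = ψ ⁻¹' D' := by
    rw [← hD.closure_eq, ← hDc.closure_interior_eq_closure_of_nonempty_interior hiD, hint,
      ← ψ.preimage_closure, hDc'.closure_interior_eq_closure_of_nonempty_interior hiD',
      hD'.closure_eq]
  exact ⟨r' • v, fun x => by rw [← hψx]; exact iff_of_eq (congrArg (x ∈ ·) hcl)⟩

/-- In the equality case of the Brunn–Minkowski inequality the set `M` containing the Minkowski
combination is that combination. -/
theorem subset_combo_of_brunnMinkowski_eq {D D' M : Set (EuclideanSpace ℝ (Fin n))}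
    (hDc : Convex ℝ D) (hD : IsClosed D) (hDc' : Convex ℝ D') (hD' : IsClosed D')
    (hMc : Convex ℝ M) {r r' t : ℝ}
    (hr : 0 < r) (hr' : 0 < r') (ht0 : 0 < t) (ht1 : t < 1)
    (hv : volume D = ENNReal.ofReal (r ^ n)) (hv' : volume D' = ENNReal.ofReal (r' ^ n))
    (hM : (1 - t) • D + t • D' ⊆ M)
    (hvM : volume M = ENNReal.ofReal (((1 - t) * r + t * r') ^ n)) :
    M ⊆ (1 - t) • D + t • D' := by
  have ht1' : 0 < 1 - t := by linarith
  obtain ⟨v, h⟩ := exists_homothety_of_brunnMinkowski_eq hDc hD hDc' hD' hr hr' ht0 ht1 hv hv' hM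
    hvM
  -- As `D'` is the image of `D` under `x ↦ (r'/r) x + v`, the combination contains `σ D + t v`, a
  -- closed set with the volume of `M`.
  set σ : ℝ := (1 - t) + t * (r' / r) with hσ
  have hσ0 : 0 < σ := by positivity
  have hX : (t • v) +ᵥ (σ • D) ⊆ (1 - t) • D + t • D' := by
    rintro _ ⟨_, ⟨x, hx, rfl⟩, rfl⟩
    refine ⟨(1 - t) • x, smul_mem_smul_set hx, t • ((r' / r) • x + v),
      smul_mem_smul_set ((h x).1 hx), ?_⟩
    simp only [vadd_eq_add, hσ]
    module
  have hvX : volume ((t • v) +ᵥ (σ • D)) = volume M := by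
    rw [measure_vadd, Measure.addHaar_smul, hv, hvM, finrank_euclideanSpace_fin,
      ← ENNReal.ofReal_mul (abs_nonneg _), abs_of_pos (by positivity), ← mul_pow, hσ]
    congr 2
    field_simp
  refine (hMc.subset_of_volume_le ((hD.smul₀ σ).vadd _) (hX.trans hM) ?_ hvX.ge ?_).trans hX
  · rw [hvX, hvM]; exact ENNReal.ofReal_ne_top
  · refine hMc.interior_nonempty_of_volume_ne_zero ?_
    rw [hvM]
    exact (ENNReal.ofReal_pos.2 (by positivity)).ne'

end ConvexGeometry

/-! ### The dichotomy forced by strict convexity. -/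

section StrictConvexity
open scoped Pointwise

variable {n : ℕ}

theorem exists_segment_frontier_of_mem_interior_of_notMem {L : Set (EuclideanSpace ℝ (Fin n))}
    (hL : IsClosed L) {y q : EuclideanSpace ℝ (Fin n)} (hy : y ∈ interior L) (hq : q ∉ L) :
    ∃ τ : ℝ, 0 < τ ∧ τ ≤ 1 ∧ q + τ • (y - q) ∈ frontier L := by
  have hex : ∃ c ∈ segment ℝ q y, c ∈ frontier L := by
    by_contra! h
    have hcov : segment ℝ q y ⊆ interior L ∪ Lᶜ := by
      intro c hc
      by_cases hcL : c ∈ L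
      · left
        by_contra hci
        exact h c hc (by rw [hL.frontier_eq]; exact ⟨hcL, hci⟩)
      · exact Or.inr hcL
    obtain ⟨c, -, hc1, hc2⟩ := (convex_segment q y).isPreconnected _ _ isOpen_interior
      hL.isOpen_compl hcov ⟨y, right_mem_segment ℝ q y, hy⟩ ⟨q, left_mem_segment ℝ q y, hq⟩
    exact hc2 (interior_subset hc1)
  obtain ⟨c, hc, hcf⟩ := hex
  rw [segment_eq_image'] at hc
  obtain ⟨τ, ⟨hτ0, hτ1⟩, rfl⟩ := hc
  refine ⟨τ, lt_of_le_of_ne hτ0 ?_, hτ1, hcf⟩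
  rintro rfl
  simp only [zero_smul, add_zero] at hcf
  exact hq (hL.frontier_subset hcf)

/-- In dimension at least two, a convex set whose intersection with a closed set `L` has interior
points, and which meets the boundary of `L` in at most one point, is contained in `L`. -/
theorem subset_of_subsingleton_inter_frontier (hn : 1 < n)
    {B L : Set (EuclideanSpace ℝ (Fin n))} (hB : Convex ℝ B) (hL : IsClosed L)
    (hi : (interior (B ∩ L)).Nonempty) (hs : (B ∩ frontier L).Subsingleton) : B ⊆ L := by
  intro q hqB
  by_contra hq
  obtain ⟨y, hy⟩ := hi
  -- Dimension at least two provides two interior points seen from `q` in different directions;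
  -- their segments to `q` meet `∂L` in distinct points.
  obtain ⟨e, he⟩ : ∃ e, e ∉ Submodule.span ℝ {y - q} := by
    by_contra! h
    have htop : Submodule.span ℝ {y - q} = ⊤ := by
      rw [eq_top_iff]; exact fun x _ => h x
    have h1 := finrank_span_le_card (R := ℝ) ({y - q} : Set (EuclideanSpace ℝ (Fin n)))
    rw [htop, finrank_top, finrank_euclideanSpace_fin] at h1
    simp at h1
    omega
  obtain ⟨ε, hε, hε0⟩ : ∃ ε : ℝ, y + ε • e ∈ interior (B ∩ L) ∧ 0 < ε := by
    have hc : ContinuousAt (fun ε : ℝ => y + ε • e) 0 := by fun_prop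
    have h5 : ∀ᶠ ε : ℝ in nhdsWithin 0 (Ioi 0), y + ε • e ∈ interior (B ∩ L) :=
      nhdsWithin_le_nhds (hc.preimage_mem_nhds (isOpen_interior.mem_nhds (by simpa using hy)))
    exact (h5.and self_mem_nhdsWithin).exists
  have hcross : ∀ z ∈ interior (B ∩ L), ∃ τ : ℝ, 0 < τ ∧ q + τ • (z - q) ∈ B ∩ frontier L := by
    intro z hz
    obtain ⟨τ, h0, h1, hf⟩ := exists_segment_frontier_of_mem_interior_of_notMem hL
      (interior_mono inter_subset_right hz) hq
    exact ⟨τ, h0, hB.add_smul_sub_mem hqB (interior_subset hz).1 ⟨h0.le, h1⟩, hf⟩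
  obtain ⟨τ₁, h1, hf1⟩ := hcross _ hy
  obtain ⟨τ₂, h2, hf2⟩ := hcross _ hε
  have heq : τ₁ • (y - q) = τ₂ • (y + ε • e - q) := add_left_cancel (hs hf1 hf2)
  refine he (Submodule.mem_span_singleton.2 ⟨(τ₂ * ε)⁻¹ * (τ₁ - τ₂), ?_⟩)
  have h3 : (τ₁ - τ₂) • (y - q) = (τ₂ * ε) • e := by
    rw [sub_smul, heq]; module
  rw [mul_smul, h3, smul_smul, inv_mul_cancel₀ (mul_pos h2 hε0).ne', one_smul]

theorem StrictConvex.eq_of_combo_notMem_interior {L : Set (EuclideanSpace ℝ (Fin n))}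
    (hL : StrictConvex ℝ L) {x y : EuclideanSpace ℝ (Fin n)} (hx : x ∈ L) (hy : y ∈ L) {t : ℝ}
    (ht0 : 0 < t) (ht1 : t < 1) (h : (1 - t) • x + t • y ∉ interior L) : x = y := by
  by_contra hne
  exact h (hL hx hy hne (by linarith) ht0 (by ring))

/-- The part of `L` whose translate by `s • w` lies in `B`. -/
def shiftInter (B L : Set (EuclideanSpace ℝ (Fin n))) (w : EuclideanSpace ℝ (Fin n)) (s : ℝ) :
    Set (EuclideanSpace ℝ (Fin n)) :=
  L ∩ (fun x => x + s • w) ⁻¹' B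

variable {B L : Set (EuclideanSpace ℝ (Fin n))} {w : EuclideanSpace ℝ (Fin n)}

theorem mem_shiftInter {s : ℝ} {x : EuclideanSpace ℝ (Fin n)} :
    x ∈ shiftInter B L w s ↔ x ∈ L ∧ x + s • w ∈ B := Iff.rfl

theorem isClosed_shiftInter (hB : IsClosed B) (hL : IsClosed L) (s : ℝ) :
    IsClosed (shiftInter B L w s) :=
  hL.inter (hB.preimage (by fun_prop))

theorem convex_shiftInter (hB : Convex ℝ B) (hL : Convex ℝ L) (s : ℝ) :
    Convex ℝ (shiftInter B L w s) :=
  hL.inter (hB.translate_preimage_left _)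

theorem combo_shiftInter_subset (hB : Convex ℝ B) (hL : Convex ℝ L) {s s' t : ℝ} (ht0 : 0 < t)
    (ht1 : t < 1) : (1 - t) • shiftInter B L w s + t • shiftInter B L w s' ⊆
      shiftInter B L w ((1 - t) * s + t * s') := by
  have ht1' : 0 < 1 - t := by linarith
  rintro _ ⟨_, ⟨x, hx, rfl⟩, _, ⟨y, hy, rfl⟩, rfl⟩
  refine ⟨hL hx.1 hy.1 ht1'.le ht0.le (by ring), ?_⟩
  have := hB hx.2 hy.2 ht1'.le ht0.le (by ring)
  simp only [mem_preimage]
  convert this using 1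
  module

/-- The alternatives are whether `B` meets `∂L` in at least two points or in at most one. -/
theorem shiftInter_const_or_subset (hn : 1 < n) (hB : IsClosed B) (hBc : Convex ℝ B)
    (hL : IsClosed L) (hLs : StrictConvex ℝ L) {α β : ℝ}
    (hr : ∀ s ∈ Ioo (-1 : ℝ) 1, 0 < α + β * s)
    (hv : ∀ s ∈ Ioo (-1 : ℝ) 1,
      volume (shiftInter B L w s) = ENNReal.ofReal ((α + β * s) ^ n)) :
    (∀ s ∈ Ioo (-1 : ℝ) 1, shiftInter B L w s = shiftInter B L w 0) ∨
      ((∀ s ∈ Ioo (-1 : ℝ) 1, ∀ x, x + s • w ∈ B → x ∈ L) ∧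
        ((B ∩ frontier L).Nonempty → w = 0)) := by
  have hLc := hLs.convex
  have hcl := isClosed_shiftInter (w := w) hB hL
  have hcv := convex_shiftInter (w := w) hBc hLc
  have h0 : (0 : ℝ) ∈ Ioo (-1 : ℝ) 1 := by norm_num
  have hvol : ∀ {s s' t : ℝ}, s ∈ Ioo (-1 : ℝ) 1 → s' ∈ Ioo (-1 : ℝ) 1 → 0 < t → t < 1 →
      volume (shiftInter B L w ((1 - t) * s + t * s')) =
        ENNReal.ofReal (((1 - t) * (α + β * s) + t * (α + β * s')) ^ n) := by
    intro s s' t hs hs' ht0 ht1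
    have hmem : (1 - t) * s + t * s' ∈ Ioo (-1 : ℝ) 1 :=
      convex_Ioo (-1 : ℝ) 1 hs hs' (by linarith) ht0.le (sub_add_cancel 1 t)
    rw [hv _ hmem]
    congr 2
    ring
  have hboundary : ∀ {s s' t : ℝ}, s ∈ Ioo (-1 : ℝ) 1 → s' ∈ Ioo (-1 : ℝ) 1 → 0 < t → t < 1 →
      ∀ p ∈ shiftInter B L w ((1 - t) * s + t * s'), p ∉ interior L →
        p ∈ shiftInter B L w s := by
    intro s s' t hs hs' ht0 ht1 p hp hpi
    obtain ⟨_, ⟨x, hx, rfl⟩, _, ⟨y, hy, rfl⟩, rfl⟩ := subset_combo_of_brunnMinkowski_eq (hcv s)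
      (hcl s) (hcv s') (hcl s') (hcv _) (hr s hs) (hr s' hs') ht0 ht1 (hv s hs) (hv s' hs')
      (combo_shiftInter_subset hBc hLc ht0 ht1) (hvol hs hs' ht0 ht1) hp
    have hxy := hLs.eq_of_combo_notMem_interior hx.1 hy.1 ht0 ht1 hpi
    subst hxy
    simp only
    rwa [← add_smul, sub_add_cancel, one_smul]
  have hzero : ∀ s ∈ Ioo (-1 : ℝ) 1, ∀ p ∈ shiftInter B L w 0, p ∉ interior L →
      p ∈ shiftInter B L w s := by
    intro s hs p hp hpi
    refine hboundary (s' := -s) (t := 1 / 2) hs ⟨by linarith [hs.2], by linarith [hs.1]⟩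
      (by norm_num) (by norm_num) p ?_ hpi
    rwa [show (1 - 1 / 2 : ℝ) * s + 1 / 2 * -s = 0 by ring]
  have hzero' : ∀ s ∈ Ioo (-1 : ℝ) 1, ∀ p ∈ shiftInter B L w s, p ∉ interior L →
      p ∈ shiftInter B L w 0 := by
    intro s hs p hp hpi
    have hs1 : |s| < 1 := abs_lt.2 hs
    have ht : 0 < (1 + |s|) / 2 := by positivity
    -- Since `|s| < (1 + |s|) / 2 < 1`, the parameter `s` lies strictly between 0 and an admissible
    -- `s'` (for `s = 0` all three agree).
    refine hboundary (s' := s / ((1 + |s|) / 2)) (t := (1 + |s|) / 2) h0 ?_ ht (by linarith) p ?_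
      hpi
    · rw [mem_Ioo, ← abs_lt, abs_div, abs_of_pos ht, div_lt_one ht]; linarith
    · rwa [mul_zero, zero_add, mul_div_cancel₀ _ ht.ne']
  have hpos : ∀ s ∈ Ioo (-1 : ℝ) 1, (interior (shiftInter B L w s)).Nonempty := fun s hs =>
    (hcv s).interior_nonempty_of_volume_ne_zero (by
      rw [hv s hs]; exact (ENNReal.ofReal_pos.2 (pow_pos (hr s hs) n)).ne')
  by_cases hsub : (B ∩ frontier L).Subsingleton
  · right
    have hincl : ∀ s ∈ Ioo (-1 : ℝ) 1, ∀ x, x + s • w ∈ B → x ∈ L := by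
      intro s hs
      refine subset_of_subsingleton_inter_frontier (B := (fun x => x + s • w) ⁻¹' B) hn
        (hBc.translate_preimage_left _) hL ?_ (hsub.anti ?_)
      · rw [inter_comm]; exact hpos s hs
      · rintro p ⟨hpB, hpf⟩
        have hpf' := hpf
        rw [hL.frontier_eq] at hpf'
        have := (hzero' s hs p ⟨hpf'.1, hpB⟩ hpf'.2).2
        exact ⟨by simpa using this, hpf⟩
    refine ⟨hincl, ?_⟩
    rintro ⟨p, hpB, hpf⟩
    rw [hL.frontier_eq] at hpf
    have hmem : ∀ s ∈ Ioo (-1 : ℝ) 1, p + s • w ∈ L := by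
      intro s hs
      have h1 := (hzero s hs p ⟨hpf.1, by simpa using hpB⟩ hpf.2).2
      exact hincl 0 h0 _ (by simpa using h1)
    -- The boundary point `p` is the midpoint of `p ± w/2`, both in `L`.
    have h2 := hLs.eq_of_combo_notMem_interior (hmem (-(1 / 2)) (by norm_num))
      (hmem (1 / 2) (by norm_num)) (t := 1 / 2) (by norm_num) (by norm_num) (by
        convert hpf.2 using 2
        module)
    have h3 := add_left_cancel h2
    have h4 : w = (1 / 2 : ℝ) • w - (-(1 / 2) : ℝ) • w := by module
    rw [h4, h3, sub_self]
  · left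
    intro s hs
    rw [not_subsingleton_iff] at hsub
    obtain ⟨p, ⟨hpB, hpf⟩, q, ⟨hqB, hqf⟩, hpq⟩ := hsub
    rw [hL.frontier_eq] at hpf hqf
    obtain ⟨v, hφ⟩ := exists_homothety_of_brunnMinkowski_eq (t := 1 / 2) (hcv 0) (hcl 0) (hcv s)
      (hcl s) (hr 0 h0) (hr s hs) (by norm_num) (by norm_num) (hv 0 h0) (hv s hs)
      (combo_shiftInter_subset hBc hLc (by norm_num) (by norm_num))
      (hvol h0 hs (by norm_num) (by norm_num))
    set ρ := (α + β * s) / (α + β * 0) with hρ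
    have hρ0 : 0 < ρ := div_pos (hr s hs) (hr 0 h0)
    have hfix : ∀ p ∈ B, p ∈ L \ interior L → ρ • p + v = p := by
      intro p hpB hpf
      have hp0 : p ∈ shiftInter B L w 0 := ⟨hpf.1, by simpa using hpB⟩
      have hps := hzero s hs p hp0 hpf.2
      have hx : ρ • (ρ⁻¹ • (p - v)) + v = p := by
        rw [smul_smul, mul_inv_cancel₀ hρ0.ne', one_smul, sub_add_cancel]
      set x := ρ⁻¹ • (p - v) with hxdef
      have hx0 : x ∈ shiftInter B L w 0 := (hφ x).2 (by rwa [hx])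
      have hy := (hφ p).1 hp0
      -- With `φ x = ρ x + v` one has `φ p - p = φ p - φ x = ρ (p - x)`, so `p` lies between its
      -- preimage `x` and its image `φ p`, both in `L`. Strict convexity then makes `p` a fixed
      -- point.
      have hcombo : (1 - 1 / (1 + ρ)) • x + (1 / (1 + ρ)) • (ρ • p + v) = p := by
        have hv' : v = p - ρ • x := by rw [← hx]; module
        rw [hv']
        match_scalars <;> field_simp <;> ring
      have hxy := hLs.eq_of_combo_notMem_interior hx0.1 hy.1 (t := 1 / (1 + ρ)) (by positivity)
        (by rw [div_lt_one (by positivity)]; linarith) (by rw [hcombo]; exact hpf.2)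
      rw [← hxy, ← add_smul, sub_add_cancel, one_smul] at hcombo
      rw [← hxy, hcombo]
    have hp := hfix p hpB hpf
    have hq := hfix q hqB hqf
    have hρ1 : ρ = 1 := by
      have h1 : (ρ - 1) • (p - q) = 0 := by
        have : (ρ - 1) • (p - q) = (ρ • p + v - p) - (ρ • q + v - q) := by module
        rw [this, hp, hq]; simp
      rcases smul_eq_zero.1 h1 with h | h
      · linarith
      · exact absurd (sub_eq_zero.1 h) hpq
    have hv0 : v = 0 := by
      rw [hρ1, one_smul] at hp
      simpa using hp
    ext x
    rw [hφ x, hρ1, hv0, one_smul, add_zero]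

end StrictConvexity

/-! ### From constant intersections to the cylinder and boundary segments. -/

section Conclusion

variable {n : ℕ} {B L : Set (EuclideanSpace ℝ (Fin n))} {w : EuclideanSpace ℝ (Fin n)}

theorem IsClosed.mem_of_forall_Ioo {X : Type*} [TopologicalSpace X] {C : Set X} (hC : IsClosed C)
    {g : ℝ → X} (hg : Continuous g) (h : ∀ δ ∈ Ioo (0 : ℝ) 1, g δ ∈ C) : g 0 ∈ C := by
  have h1 : closure (Ioo (0 : ℝ) 1) ⊆ g ⁻¹' C := closure_minimal h (hC.preimage hg)
  rw [closure_Ioo zero_ne_one] at h1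
  exact h1 (left_mem_Icc.2 zero_le_one)

/-- Passage to the endpoints `s = ±1`: parameters are shrunk to `(1 - δ) s`, and `δ → 0` uses
closedness. -/
theorem shiftInter_eq_of_mem_Icc (hB : IsClosed B) (hBc : Convex ℝ B) (hL : IsClosed L)
    (hLc : Convex ℝ L) (hne : (shiftInter B L w 0).Nonempty)
    (h : ∀ s ∈ Ioo (-1 : ℝ) 1, shiftInter B L w s = shiftInter B L w 0) :
    ∀ s ∈ Icc (-1 : ℝ) 1, shiftInter B L w s = shiftInter B L w 0 := by
  intro s hs
  have hmem : ∀ δ ∈ Ioo (0 : ℝ) 1, (1 - δ) * s ∈ Ioo (-1 : ℝ) 1 := by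
    intro δ hδ
    have h1 : 0 < 1 - δ := by linarith [hδ.2]
    constructor <;> nlinarith [hδ.1, hs.1, hs.2]
  apply Subset.antisymm
  · intro x hx
    obtain ⟨y, hy⟩ := hne
    have := (isClosed_shiftInter (w := w) hB hL 0).mem_of_forall_Ioo
      (g := fun δ : ℝ => (1 - δ) • x + δ • y) (by fun_prop) (by
        intro δ hδ
        rw [← h _ (hmem δ hδ)]
        have h2 := combo_shiftInter_subset hBc hLc hδ.1 hδ.2
          (Set.add_mem_add (Set.smul_mem_smul_set hx) (Set.smul_mem_smul_set hy))
        rwa [mul_zero, add_zero] at h2)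
    simpa using this
  · intro x hx
    refine ⟨hx.1, ?_⟩
    have := hB.mem_of_forall_Ioo (g := fun δ : ℝ => x + ((1 - δ) * s) • w) (by fun_prop) (by
        intro δ hδ
        have h2 := hx
        rw [← h _ (hmem δ hδ)] at h2
        exact h2.2)
    simpa using this

/-- If the part of `L` in `B` does not change under the translations of `B` by `s • w`,
`|s| ≤ 1`, then within `L` the set `B` is a cylinder in the direction of `w`. -/
theorem mem_of_add_smul_mem (hB : IsClosed B) (hBc : Convex ℝ B) (hLc : Convex ℝ L)
    (hne : (shiftInter B L w 0).Nonempty)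
    (h : ∀ s ∈ Icc (-1 : ℝ) 1, shiftInter B L w s = shiftInter B L w 0)
    {q : EuclideanSpace ℝ (Fin n)} (hq : q ∈ L) {r : ℝ} (hqr : q + r • w ∈ B) : q ∈ B := by
  obtain ⟨y, hy⟩ := hne
  -- This choice gives `|δ r| ≤ 1`. Moving a point of `D_0` the fraction `δ` towards `q` lands in
  -- `D_(δ r) = D_0`; iterating, the points converge to `q`, and `B` is closed.
  set δ : ℝ := 1 / (1 + |r|) with hδ
  have hδ0 : 0 < δ := by positivity
  have hδ1 : δ ≤ 1 := by
    rw [hδ, div_le_one (by positivity)]; linarith [abs_nonneg r]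
  have hδr : δ * r ∈ Icc (-1 : ℝ) 1 := by
    rw [mem_Icc, ← abs_le, abs_mul, abs_of_pos hδ0, hδ, one_div_mul_eq_div,
      div_le_one (by positivity)]
    linarith
  have hk : ∀ k : ℕ, q + (1 - δ) ^ k • (y - q) ∈ shiftInter B L w 0 := by
    intro k
    induction k with
    | zero => simpa using hy
    | succ k ih =>
      rw [← h _ hδr]
      have hyB := ih.2
      simp only [mem_preimage, zero_smul, add_zero] at hyB
      have h1 := hLc ih.1 hq (by linarith : 0 ≤ 1 - δ) hδ0.le (by ring)
      have h2 := hBc hyB hqr (by linarith : 0 ≤ 1 - δ) hδ0.le (by ring)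
      refine ⟨?_, ?_⟩
      · convert h1 using 1
        module
      · simp only [mem_preimage]
        convert h2 using 1
        module
  have hlim : Filter.Tendsto (fun k : ℕ => q + (1 - δ) ^ k • (y - q)) Filter.atTop
      (nhds (q + (0 : ℝ) • (y - q))) :=
    ((tendsto_pow_atTop_nhds_zero_of_lt_one (by linarith) (by linarith)).smul_const _).const_add _
  rw [zero_smul, add_zero] at hlim
  exact hB.mem_of_tendsto hlim (Filter.Eventually.of_forall fun k => by
    simpa using (hk k).2)

theorem mem_translateSet_iff {L : Set (EuclideanSpace ℝ (Fin n))}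
    {x z : EuclideanSpace ℝ (Fin n)} : z ∈ translateSet L x ↔ z - x ∈ L := by
  constructor
  · rintro ⟨y, hy, rfl⟩
    simpa using hy
  · intro h
    exact ⟨z - x, h, by simp⟩

theorem crossCovariogram_eq_volume_shiftInter (K L : Set (EuclideanSpace ℝ (Fin n)))
    (a w : EuclideanSpace ℝ (Fin n)) (s : ℝ) :
    crossCovariogram K L (a + s • w) = volume (shiftInter ((fun x => x + a) ⁻¹' K) L w s) := by
  rw [crossCovariogram, ← measure_preimage_add_right volume (a + s • w)]
  congr 1
  ext x
  simp only [mem_preimage, mem_inter_iff, mem_translateSet_iff, mem_shiftInter,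
    add_sub_cancel_right]
  rw [and_comm, show x + (a + s • w) = x + s • w + a by abel]

/-- If `z + σ w` were interior to `K`, then `z`, its midpoint with `z - σ w ∈ K`, would be interior
too. -/
theorem segment_subset_frontier {K : Set (EuclideanSpace ℝ (Fin n))} (hK : Convex ℝ K)
    {z w : EuclideanSpace ℝ (Fin n)} (hz : z ∈ frontier K)
    (h : ∀ s ∈ Icc (-1 : ℝ) 1, z + s • w ∈ K) : segment ℝ (z - w) (z + w) ⊆ frontier K := by
  intro y hy
  rw [segment_eq_image'] at hy
  obtain ⟨θ, ⟨h0, h1⟩, rfl⟩ := hy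
  have hy : z - w + θ • (z + w - (z - w)) = z + (2 * θ - 1) • w := by module
  simp only [hy]
  refine ⟨subset_closure (h _ ⟨by linarith, by linarith⟩), fun hint => hz.2 ?_⟩
  have h2 := hK.combo_interior_self_mem_interior hint
    (h (-(2 * θ - 1)) ⟨by linarith, by linarith⟩) (a := 1 / 2) (b := 1 / 2) (by norm_num)
    (by norm_num) (by norm_num)
  convert h2 using 1
  module

end Conclusion

/-! ### The main theorem. -/

theorem mainTheorem6 {n : ℕ} (K L : Set (EuclideanSpace ℝ (Fin n)))
    (hKL : StandingHypothesis K L) (hL : StrictConvex ℝ L)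
    (a w : EuclideanSpace ℝ (Fin n))
    (haff : IsAffineOnSegment (crossCovariogramRoot K L) a w)
    (hne : ∃ t ∈ Icc (-1 : ℝ) 1, crossCovariogramRoot K L (a + t • w) ≠ 0) :
    (∃ c : ℝ≥0∞, ∀ t ∈ Icc (-1 : ℝ) 1, crossCovariogramRoot K L (a + t • w) = c) ∧
    (¬ K ⊆ interior (translateSet L a) →
      (∀ t ∈ Icc (-1 : ℝ) 1,
        K ∩ translateSet L (a + t • w) = cylinderSet K w ∩ translateSet L (a + t • w)) ∧
      (∀ z ∈ frontier K ∩ translateSet L a, segment ℝ (z - w) (z + w) ⊆ frontier K)) := by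
  obtain ⟨α, β, haff⟩ := haff
  have hn := hKL.one_lt_dim
  have hn0 : n ≠ 0 := by omega
  have hLcl := hKL.isClosed_right
  set B : Set (EuclideanSpace ℝ (Fin n)) := (fun x => x + a) ⁻¹' K with hB
  have hBcl : IsClosed B := hKL.isClosed_left.preimage (by fun_prop)
  have hBcv : Convex ℝ B := hKL.convex_left.translate_preimage_left a
  have hmemB : ∀ x, x ∈ B ↔ x + a ∈ K := fun x => Iff.rfl
  have h0 : (0 : ℝ) ∈ Ioo (-1 : ℝ) 1 := by norm_num
  -- An affine function that is non-negative on `[-1, 1]` and vanishes at an interior point is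
  -- identically zero.
  have hr : ∀ s ∈ Ioo (-1 : ℝ) 1, 0 < α + β * s := by
    intro s hs
    refine lt_of_le_of_ne (haff s (Ioo_subset_Icc_self hs)).1 fun h => ?_
    have h1 := (haff 1 (by norm_num)).1
    have h2 := (haff (-1) (by norm_num)).1
    have hβ : β = 0 := by
      apply le_antisymm
      · nlinarith [hs.1, hs.2]
      · nlinarith [hs.1, hs.2]
    have hα : α = 0 := by rw [hβ] at h; linarith
    obtain ⟨t, ht, htne⟩ := hne
    refine htne ?_
    rw [(haff t ht).2, hα, hβ]
    simp
  have hv : ∀ s ∈ Ioo (-1 : ℝ) 1,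
      volume (shiftInter B L w s) = ENNReal.ofReal ((α + β * s) ^ n) := by
    intro s hs
    obtain ⟨hnn, hroot⟩ := haff s (Ioo_subset_Icc_self hs)
    rw [← crossCovariogram_eq_volume_shiftInter, ENNReal.ofReal_pow hnn, ← hroot,
      crossCovariogramRoot, one_div, ENNReal.rpow_inv_natCast_pow hn0]
  have hD0 : (shiftInter B L w 0).Nonempty := nonempty_of_measure_ne_zero (μ := volume) (by
    rw [hv 0 h0]; exact (ENNReal.ofReal_pos.2 (pow_pos (hr 0 h0) n)).ne')
  have hhalf : (1 / 2 : ℝ) ∈ Ioo (-1 : ℝ) 1 := by norm_num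
  have halt := shiftInter_const_or_subset hn hBcl hBcv hLcl hL hr hv
  constructor
  · have hvol : volume (shiftInter B L w (1 / 2)) = volume (shiftInter B L w 0) := by
      rcases halt with h | ⟨h, -⟩
      · rw [h _ hhalf]
      · have heq : ∀ s ∈ Ioo (-1 : ℝ) 1, volume (shiftInter B L w s) = volume B := by
          intro s hs
          rw [shiftInter, inter_eq_right.2 (show (fun x => x + s • w) ⁻¹' B ⊆ L from h s hs),
            measure_preimage_add_right]
        rw [heq _ hhalf, heq _ h0]
    have hβ : β = 0 := by
      rw [hv _ hhalf, hv _ h0, ENNReal.ofReal_eq_ofReal_iff (pow_pos (hr _ hhalf) n).le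
        (pow_pos (hr _ h0) n).le, pow_left_inj₀ (hr _ hhalf).le (hr _ h0).le hn0] at hvol
      linarith
    refine ⟨ENNReal.ofReal α, fun t ht => ?_⟩
    rw [(haff t ht).2, hβ, zero_mul, add_zero]
  · intro hK
    have hper : ∀ s ∈ Icc (-1 : ℝ) 1, shiftInter B L w s = shiftInter B L w 0 := by
      rcases halt with h | ⟨h, hw⟩
      · exact shiftInter_eq_of_mem_Icc hBcl hBcv hLcl hL.convex hD0 h
      · obtain ⟨k, hk, hki⟩ := not_subset.1 hK
        have hkB : k - a ∈ B := by simpa [hmemB] using hk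
        have hkL : k - a ∈ L := h 0 h0 _ (by simpa using hkB)
        have hkf : k - a ∉ interior L := by
          intro hint
          refine hki ?_
          have : translateSet L a = Homeomorph.addRight a '' L := rfl
          rw [this, ← Homeomorph.image_interior]
          exact ⟨k - a, hint, by simp⟩
        have hw0 := hw ⟨k - a, hkB, by rw [hLcl.frontier_eq]; exact ⟨hkL, hkf⟩⟩
        intro s _
        simp [shiftInter, hw0]
    refine ⟨fun t ht => ?_, ?_⟩
    · refine Subset.antisymm
        (inter_subset_inter_left _ fun x hx => ⟨x, hx, 0, by simp⟩) ?_
      rintro q ⟨⟨x, hx, r, rfl⟩, hqL⟩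
      refine ⟨?_, hqL⟩
      rw [mem_translateSet_iff] at hqL
      set l := x + r • w - (a + t • w) with hl
      -- Shifting `l` by `(t - r) w` gives `x - a ∈ B`, so `l` itself is in `B`; then `l ∈ D_0 =
      -- D_t` returns `x + r w ∈ K`.
      have h1 : l ∈ B := mem_of_add_smul_mem hBcl hBcv hL.convex hD0 hper hqL (r := t - r) (by
        rw [hmemB, hl]
        convert hx using 1
        module)
      have h2 : l ∈ shiftInter B L w t := by
        rw [hper t ht]; exact ⟨hqL, by simpa using h1⟩
      have h3 := (hmemB _).1 h2.2
      convert h3 using 1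
      rw [hl]
      module
    · rintro z ⟨hzf, hzL⟩
      rw [mem_translateSet_iff] at hzL
      have hzK : z ∈ K := hKL.isClosed_left.frontier_subset hzf
      refine segment_subset_frontier hKL.convex_left hzf fun s hs => ?_
      have h2 : z - a ∈ shiftInter B L w s := by
        rw [hper s hs]
        exact ⟨hzL, by simpa [hmemB] using hzK⟩
      have h3 := (hmemB _).1 h2.2
      convert h3 using 1
      module
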